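/- **Theorem (MIMO channels – sufficiency).** Let $S_{t+1}=AS_t+W_t$ be a Gauss–Markov source in $\mathbb R^k$, with $A\in\mathbb R^{k\times k}$, $W_t\sim\mathcal N(0,Q)$ i.i.d., $S_0\sim\mathcal N(0,Q)$ independent of $(W_t)$, and $Q\succ0$. Assume that the (complex) eigenvalues $\lambda_1,\dots,\lambda_k$ of $A$ are distinct and that $|\lambda_j|>1$ for all $j$. Let $Y_t=HX_t+Z_t$ be an $n$-input AWGN channel with $H=\mathrm{diag}(h_1,\dots,h_n)$, real $h_i$, and $Z_t\sim\mathcal N(0,I)$ i.i.d. and independent of the source. A *zero-delay feedback code with a linear encoder* forms the channel inputs $$X_t=\sum_{s\le t}\Xi_{t,s}S_s+\sum_{s<t}\Psi_{t,s}Y_s+M_t,\qquad t\ge0,$$ with deterministic matrices $\Xi_{t,s},\Psi_{t,s}$ and Gaussian $M_t\sim\mathcal N(0,\Theta_t)$, $\Theta_t\succeq0$, that are independent of each other, of the source and of the channel noise; its decoder predicts $S_{t+1}$ by $\hat S_{t+1}=g_t(Y_0,\dots,Y_t)$ with $g_t$ measurable. It is a *$(p,D)$ code* if $$\limsup_{T\to\infty}\frac1T\sum_{t=1}^T\mathbb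 E\,[X_t^{\mathsf T}X_t]\le p,\qquad \limsup_{T\to\infty}\frac1T\sum_{t=1}^T\mathbb E\,\|S_t-\hat S_t\|^2\le D .$$ Suppose that there are pairwise disjoint, possibly empty sets $\mathcal S_1,\dots,\mathcal S_n$ with union $\{1,\dots,k\}$ and numbers $\pi_1,\dots,\pi_n\ge0$ with $\sum_{i=1}^n\pi_i=p$ such that $$\sum_{j\in\mathcal S_i}\log|\lambda_j|<\tfrac12\log\bigl(1+h_i^2\pi_i\bigr)\qquad\text{for every } i \text{ with } \mathcal S_i\neq\emptyset .$$ Then finite mean-squared error is achievable with linear encoders: for some $D<\infty$ there is a $(p,D)$ code with a linear encoder. Moreover the encoder can be chosen so that each mode is sent over a single sub-channel: for all $i$ and $s\le t$, the $i$-th row of $\Xi_{t,s}$ is the real part of a complex linear combination of left eigenvectors of $A$ for the eigenvalues $\lambda_j$, $j\in\mathcal S_i$ (if $A$ is diagonal, this row is supported on $\mathcal S_i$). -/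

import Mathlib

open MeasureTheory ProbabilityTheory Filter
open scoped ENNReal NNReal Matrix

universe u

noncomputable section

namespace ZeroDelayJSCC

/-- The Gauss-Markov source along one sample path: `S_0 = s₀` and `S_{t+1} = A S_t + W_t`. -/
def source {k : ℕ} (A : Matrix (Fin k) (Fin k) ℝ) (s₀ : EuclideanSpace ℝ (Fin k))
    (w : ℕ → EuclideanSpace ℝ (Fin k)) : ℕ → EuclideanSpace ℝ (Fin k)
  | 0 => s₀
  | t + 1 => Matrix.toEuclideanLin A (source A s₀ w t) + w t

/-- A zero-delay feedback code with a linear encoder, for a source in `ℝ^k` and a channel with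
`n` inputs and `n` outputs. At time `t` the encoder forms
`X_t = ∑_{s ≤ t} Ξ_{t,s} S_s + ∑_{s < t} Ψ_{t,s} Y_s + M_t`, where `M_t ∼ N(0, Θ_t)`; only the
entries `Ξ t s` with `s ≤ t` and `Ψ t s` with `s < t` are ever used. At time `t` the decoder
computes `g t (Y_0, …, Y_t)`, its prediction of the next state `S_{t+1}`. -/
structure LinearCode (k n : ℕ) where
  Ξ : ℕ → ℕ → Matrix (Fin n) (Fin k) ℝ
  Ψ : ℕ → ℕ → Matrix (Fin n) (Fin n) ℝ
  Θ : ℕ → Matrix (Fin n) (Fin n) ℝ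
  Θ_posSemidef : ∀ t, (Θ t).PosSemidef
  g : (t : ℕ) → (Fin (t + 1) → EuclideanSpace ℝ (Fin n)) → EuclideanSpace ℝ (Fin k)
  g_measurable : ∀ t, Measurable (g t)

namespace LinearCode

variable {k n : ℕ}

/-- The channel input at time `t`, from the source path `s`, the past channel outputs `y` and
the path `m` of the additive encoder term. -/
def encode (c : LinearCode k n) (t : ℕ) (s : ℕ → EuclideanSpace ℝ (Fin k))
    (y : Fin t → EuclideanSpace ℝ (Fin n)) (m : ℕ → EuclideanSpace ℝ (Fin n)) :
    EuclideanSpace ℝ (Fin n) :=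
  ∑ r ∈ Finset.range (t + 1), Matrix.toEuclideanLin (c.Ξ t r) (s r) +
    ∑ r : Fin t, Matrix.toEuclideanLin (c.Ψ t r) (y r) + m t

/-- The channel output `Y_t = H X_t + Z_t`, `H = diag(h_1, …, h_n)`, along one sample path, when
the channel inputs are formed by the code `c` with noiseless feedback of the past outputs. -/
def output (c : LinearCode k n) (h : Fin n → ℝ) (s : ℕ → EuclideanSpace ℝ (Fin k))
    (z m : ℕ → EuclideanSpace ℝ (Fin n)) (t : ℕ) : EuclideanSpace ℝ (Fin n) :=
  Matrix.toEuclideanLin (Matrix.diagonal h)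
    (c.encode t s (fun r : Fin t => output c h s z m r) m) + z t
termination_by t
decreasing_by exact r.2

/-- The channel input `X_t` along one sample path. -/
def input (c : LinearCode k n) (h : Fin n → ℝ) (s : ℕ → EuclideanSpace ℝ (Fin k))
    (z m : ℕ → EuclideanSpace ℝ (Fin n)) (t : ℕ) : EuclideanSpace ℝ (Fin n) :=
  c.encode t s (fun r : Fin t => c.output h s z m r) m

/-- The decoder's prediction of `S_t` along one sample path: it is `0` at time `0`, and
at time `t + 1` it is computed from the outputs `Y_0, …, Y_t`. -/
def estimate (c : LinearCode k n) (h : Fin n → ℝ) (s : ℕ → EuclideanSpace ℝ (Fin k))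
    (z m : ℕ → EuclideanSpace ℝ (Fin n)) : ℕ → EuclideanSpace ℝ (Fin k)
  | 0 => 0
  | t + 1 => c.g t (fun r : Fin (t + 1) => c.output h s z m r)

/-- The random variables that drive the system: the initial state `S₀ ∼ N(0, Q)`, the i.i.d.
source noise `W_t ∼ N(0, Q)`, the i.i.d. channel noise `Z_t ∼ N(0, I)`, and the additive encoder
terms `M_t ∼ N(0, Θ_t)`, all independent. -/
structure IsNoise {Ω : Type*} [MeasurableSpace Ω] (P : Measure Ω) (Q : Matrix (Fin k) (Fin k) ℝ)
    (Θ : ℕ → Matrix (Fin n) (Fin n) ℝ)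
    (S₀ : Ω → EuclideanSpace ℝ (Fin k)) (W : ℕ → Ω → EuclideanSpace ℝ (Fin k))
    (Z M : ℕ → Ω → EuclideanSpace ℝ (Fin n)) : Prop where
  measurable_S₀ : Measurable S₀
  measurable_W : ∀ t, Measurable (W t)
  measurable_Z : ∀ t, Measurable (Z t)
  measurable_M : ∀ t, Measurable (M t)
  law_S₀ : P.map S₀ = multivariateGaussian 0 Q
  law_W : ∀ t, P.map (W t) = multivariateGaussian 0 Q
  law_Z : ∀ t, P.map (Z t) = multivariateGaussian 0 1
  law_M : ∀ t, P.map (M t) = multivariateGaussian 0 (Θ t)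
  indep_W : iIndepFun W P
  indep_Z : iIndepFun Z P
  indep_M : iIndepFun M P
  indep_S₀_W : IndepFun S₀ (fun ω t => W t ω) P
  indep_source_Z : IndepFun (fun ω => (S₀ ω, fun t => W t ω)) (fun ω t => Z t ω) P
  indep_system_M :
    IndepFun (fun ω => ((S₀ ω, fun t => W t ω), fun t => Z t ω)) (fun ω t => M t ω) P

/-- The code `c` is a `(p, D)` feedback code for the source `(A, Q)` and the channel
`Y = diag(h) X + Z`: in every realization of the system, the long-term average input power is at
most `p` and the long-term average mean-squared error is at most `D`. Expectations of
squared norms and upper limits are taken in `[0, ∞]`. -/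
def IsFeedbackCode (c : LinearCode k n) (A Q : Matrix (Fin k) (Fin k) ℝ) (h : Fin n → ℝ)
    (p : ℝ) (D : ℝ≥0) : Prop :=
  ∀ (Ω : Type u) [MeasurableSpace Ω] (P : Measure Ω) [IsProbabilityMeasure P]
    (S₀ : Ω → EuclideanSpace ℝ (Fin k)) (W : ℕ → Ω → EuclideanSpace ℝ (Fin k))
    (Z M : ℕ → Ω → EuclideanSpace ℝ (Fin n)), IsNoise P Q c.Θ S₀ W Z M →
    let S : Ω → ℕ → EuclideanSpace ℝ (Fin k) := fun ω => source A (S₀ ω) (fun t => W t ω)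
    let X : Ω → ℕ → EuclideanSpace ℝ (Fin n) := fun ω =>
      c.input h (S ω) (fun t => Z t ω) (fun t => M t ω)
    let Shat : Ω → ℕ → EuclideanSpace ℝ (Fin k) := fun ω =>
      c.estimate h (S ω) (fun t => Z t ω) (fun t => M t ω)
    limsup (fun T : ℕ =>
        (T : ℝ≥0∞)⁻¹ * ∑ t ∈ Finset.Icc 1 T, ∫⁻ ω, ‖X ω t‖ₑ ^ 2 ∂P) atTop ≤ ENNReal.ofReal p ∧
    limsup (fun T : ℕ =>
        (T : ℝ≥0∞)⁻¹ * ∑ t ∈ Finset.Icc 1 T, ∫⁻ ω, ‖S ω t - Shat ω t‖ₑ ^ 2 ∂P) atTop ≤ (D : ℝ≥0∞)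

/-- The row vector `r` reads a state only through its modes with indices in `J`: `r` is the real
part of a complex linear combination of left eigenvectors of `A` for the eigenvalues `lam j`,
`j ∈ J`. If `A` is diagonal, `A = diag(lam)`, with distinct real entries, this says that `r j = 0`
for `j ∉ J`. -/
def ReadsOnlyModes (A : Matrix (Fin k) (Fin k) ℝ) (lam : Fin k → ℂ) (J : Finset (Fin k))
    (r : Fin k → ℝ) : Prop :=
  ∃ v ∈ ⨆ j ∈ J, Module.End.eigenspace (Matrix.toLin' (A.map Complex.ofReal)ᵀ) (lam j),
    ∀ a, r a = (v a).re

/-- Every source mode is sent over a single sub-channel, the modes in `𝒮 i` over sub-channel `i`: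
the source enters the input of sub-channel `i` only through the modes in `𝒮 i`. -/
def SendsModesOver (c : LinearCode k n) (A : Matrix (Fin k) (Fin k) ℝ) (lam : Fin k → ℂ)
    (𝒮 : Fin n → Finset (Fin k)) : Prop :=
  ∀ (i : Fin n) (t s : ℕ), s ≤ t → ReadsOnlyModes A lam (𝒮 i) (c.Ξ t s i)

end LinearCode

end ZeroDelayJSCC

end

/-!
The code is an error feedback code with time sharing, and all power and error bounds hold at every
single time, not only on average.

*Real modal coordinates.* Let `v_j` be left eigenvectors of `A`, with conjugate vectors for
conjugate eigenvalues. The complex modal coordinate `v_j · S_t` grows by the factor `lam j` per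
step. Turning it back by `t` times the argument of `lam j`, and taking its real part (its imaginary
part for the member of a conjugate pair in the lower half plane), gives real coordinates
`(R_t S_t)_j` that grow by the factor `‖lam j‖` and are decoupled except for correlations in the
driving noise. `R_t` is bounded and has a uniformly bounded inverse (`exists_modal_rows`). It does
not matter whether the members of a conjugate pair are assigned to the same sub-channel, since
either of them gives access to both the real and the imaginary part.

*Error feedback.* The decoder tracks `R_t S_t` by a linear recursive estimate, which the encoder
also knows by feedback, and the encoder sends multiples of the estimation errors
(`errorFeedbackCode`). At any time sub-channel `i` carries the error of one mode `j ∈ 𝒮 i` only.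
If `v` is a bound for the variance of that error, the gain `√(π i / v)` uses power at most `π i`,
and the linear minimum mean-squared error update divides `v` by `1 + h i ^ 2 * π i`
(`served_variance`). So every mode has a scalar variance recursion: the variance is multiplied by
`‖lam j‖ ^ 2`, divided by `1 + h i ^ 2 * π i` if the mode is served, and increased by at most the
variance `q` of the modal source noise (`second_moment_le`).

*Time sharing.* Under the capacity condition there is a periodic schedule that serves each
`j ∈ 𝒮 i` so often that its variance recursion contracts over a period, and hence has a bounded
supersolution (`exists_schedule_variance`).
-/

namespace ZeroDelayJSCC

/-! ### Time sharing -/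

/-- If the rates `b j`, `j ∈ S`, add up to less than `c`, then the time slots can be shared out
periodically so that every `j ∈ S` gets more than the fraction `b j / c` of them. -/
lemma exists_periodic_schedule {ι : Type*} [DecidableEq ι] (S : Finset ι) (b : ι → ℝ)
    (hb : ∀ j ∈ S, 0 ≤ b j) (c : ℝ) (hc : S.Nonempty → ∑ j ∈ S, b j < c) :
    ∃ (N : ℕ) (σ : ℕ → Option ι), 0 < N ∧ Function.Periodic σ N ∧
      (∀ t j, σ t = some j → j ∈ S) ∧
      ∀ j ∈ S, N * b j < c * ((Finset.range N).filter fun t => σ t = some j).card := by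
  rcases S.eq_empty_or_nonempty with rfl | hS
  · exact ⟨1, fun _ => none, one_pos, fun _ => rfl, by simp, by simp⟩
  have hδ : 0 < c - ∑ j ∈ S, b j := sub_pos.2 (hc hS)
  have hc0 : 0 < c := (Finset.sum_nonneg hb).trans_lt (hc hS)
  obtain ⟨N, hN⟩ := exists_nat_gt (S.card * c / (c - ∑ j ∈ S, b j))
  have hN0 : 0 < N := by
    have : (0 : ℝ) ≤ S.card * c / (c - ∑ j ∈ S, b j) := by positivity
    exact_mod_cast this.trans_lt hN
  -- The number of slots per period that are reserved for `j`.
  let m : ι → ℕ := fun j => ⌊N * b j / c⌋₊ + 1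
  let T : Finset (Σ _ : ι, ℕ) := S.sigma fun j => Finset.range (m j)
  have hT : T.card ≤ N := by
    have h1 : (T.card : ℝ) ≤ ∑ j ∈ S, (N * b j / c + 1) := by
      simp only [T, Finset.card_sigma, Finset.card_range, Nat.cast_sum]
      refine Finset.sum_le_sum fun j hj => ?_
      simp only [m, Nat.cast_add, Nat.cast_one]
      gcongr
      exact Nat.floor_le (by have := hb j hj; positivity)
    have h2 : ∑ j ∈ S, (N * b j / c + 1) = N * (∑ j ∈ S, b j) / c + S.card := by
      rw [Finset.sum_add_distrib, ← Finset.sum_div, ← Finset.mul_sum]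
      simp
    rw [div_lt_iff₀ hδ] at hN
    have h3 : N * (∑ j ∈ S, b j) / c + S.card ≤ N := by
      rw [div_add' _ _ _ hc0.ne', div_le_iff₀ hc0]
      linarith
    exact_mod_cast (h1.trans_eq h2).trans h3
  let e := T.equivFin
  let σ : ℕ → Option ι := fun t =>
    if h : t % N < T.card then some (e.symm ⟨t % N, h⟩).1.1 else none
  refine ⟨N, σ, hN0, fun t => by simp [σ], fun t j htj => ?_, fun j hj => ?_⟩
  · simp only [σ, Option.dite_none_right_eq_some, Option.some.injEq] at htj
    obtain ⟨h, rfl⟩ := htj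
    exact (Finset.mem_sigma.1 (e.symm ⟨t % N, h⟩).2).1
  · have hmem : ∀ l ∈ Finset.range (m j), (⟨j, l⟩ : Σ _ : ι, ℕ) ∈ T := fun l hl =>
      Finset.mem_sigma.2 ⟨hj, hl⟩
    have hcard : m j ≤ ((Finset.range N).filter fun t => σ t = some j).card := by
      rw [← Finset.card_range (m j), ← Finset.card_attach]
      refine Finset.card_le_card_of_injOn (fun l => (e ⟨⟨j, l.1⟩, hmem l.1 l.2⟩ : ℕ)) ?_ ?_
      · intro l _
        have hlt : (e ⟨⟨j, l.1⟩, hmem l.1 l.2⟩ : ℕ) < N := (e _).2.trans_le hT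
        simp [σ, Nat.mod_eq_of_lt hlt, hlt]
      · intro l _ l' _ h
        have := e.injective (Fin.ext h)
        exact Subtype.ext (congrArg (fun x : T => x.1.2) this)
    have h1 : N * b j / c < m j := by
      simpa [m] using Nat.lt_floor_add_one (N * b j / c)
    rw [div_lt_iff₀ hc0] at h1
    calc N * b j < m j * c := h1
      _ ≤ _ := by rw [mul_comm]; gcongr

/-- A periodic scalar recursion `v ↦ α t * v + q` that contracts over one period has a bounded
positive supersolution. -/
lemma exists_bounded_supersolution (α : ℕ → ℝ) (N : ℕ) (hN : 0 < N)
    (hα : ∀ t, 0 < α t) (hper : Function.Periodic α N)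
    (hprod : ∏ t ∈ Finset.range N, α t < 1) (q : ℝ) (hq : 0 ≤ q) :
    ∃ (v : ℕ → ℝ) (V : ℝ), q ≤ v 0 ∧
      ∀ t, 0 < v t ∧ v t ≤ V ∧ α t * v t + q ≤ v (t + 1) := by
  -- `γ` is the mean contraction per step, and `w` is the product of the factors `α t` relative
  -- to it, which is periodic.
  set β := ∏ t ∈ Finset.range N, α t with hβ
  have hβ0 : 0 < β := Finset.prod_pos fun t _ => hα t
  set γ := β ^ ((N : ℝ)⁻¹) with hγ
  have hγ0 : 0 < γ := Real.rpow_pos_of_pos hβ0 _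
  have hγ1 : γ < 1 := Real.rpow_lt_one hβ0.le hprod (by positivity)
  have hγN : γ ^ N = β := Real.rpow_inv_natCast_pow hβ0.le hN.ne'
  let w : ℕ → ℝ := fun t => ∏ s ∈ Finset.range t, α s / γ
  have hw0 : ∀ t, 0 < w t := fun t => Finset.prod_pos fun s _ => div_pos (hα s) hγ0
  have hws : ∀ t, w (t + 1) * γ = α t * w t := fun t => by
    simp only [w, Finset.prod_range_succ]
    field_simp
  have hwper : Function.Periodic w N := fun t => by
    simp only [w]
    rw [add_comm, Finset.prod_range_add]
    have h1 : ∏ s ∈ Finset.range N, α s / γ = 1 := by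
      rw [Finset.prod_div_distrib, Finset.prod_const, Finset.card_range, hγN, div_self hβ0.ne']
    rw [h1, one_mul]
    refine Finset.prod_congr rfl fun s _ => ?_
    rw [add_comm, hper]
  have hne : (Finset.range N).Nonempty := ⟨0, Finset.mem_range.2 hN⟩
  obtain ⟨t₀, -, ht₀⟩ := Finset.exists_min_image (Finset.range N) w hne
  obtain ⟨t₁, -, ht₁⟩ := Finset.exists_max_image (Finset.range N) w hne
  have hmod : ∀ t, w t = w (t % N) := fun t => (hwper.map_mod_nat t).symm
  have hmin : ∀ t, w t₀ ≤ w t := fun t => by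
    rw [hmod t]; exact ht₀ _ (Finset.mem_range.2 (Nat.mod_lt _ hN))
  have hmax : ∀ t, w t ≤ w t₁ := fun t => by
    rw [hmod t]; exact ht₁ _ (Finset.mem_range.2 (Nat.mod_lt _ hN))
  have h1γ : 0 < 1 - γ := sub_pos.2 hγ1
  set C := (q + 1) / (w t₀ * (1 - γ)) with hC
  have hC0 : 0 < C := div_pos (by linarith) (mul_pos (hw0 _) h1γ)
  have hCm : C * w t₀ * (1 - γ) = q + 1 := by
    rw [hC]; field_simp [(hw0 t₀).ne', h1γ.ne']
  have key : ∀ t, q + 1 ≤ C * w t * (1 - γ) := fun t => by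
    rw [← hCm]
    have := hmin t
    gcongr
  refine ⟨fun t => C * w t, C * w t₁, ?_, fun t => ⟨mul_pos hC0 (hw0 t), ?_, ?_⟩⟩
  · have := key 0
    have h2 : 0 < C * w 0 := mul_pos hC0 (hw0 0)
    show q ≤ C * w 0
    nlinarith
  · exact mul_le_mul_of_nonneg_left (hmax t) hC0.le
  · have h2 := key (t + 1)
    have h3 : α t * (C * w t) = C * (w (t + 1) * γ) := by rw [hws]; ring
    show α t * (C * w t) + q ≤ C * w (t + 1)
    rw [h3]
    linarith

/-- Time sharing of a channel with capacity `log ρ / 2` among unstable scalar modes with growth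
factors `a j`, `j ∈ S`: when the capacity exceeds the sum of the `log (a j)`, the slots can be
shared out such that every error variance stays bounded, if a slot divides the variance of the
mode it serves by `ρ` and noise of variance `q` enters at each step. -/
lemma exists_schedule_variance {ι : Type*} [DecidableEq ι] (S : Finset ι) (a : ι → ℝ)
    (ha : ∀ j ∈ S, 1 < a j) (ρ : ℝ) (hρ : 1 ≤ ρ)
    (hcap : S.Nonempty → ∑ j ∈ S, Real.log (a j) < 1 / 2 * Real.log ρ) (q : ℝ) (hq : 0 ≤ q) :
    ∃ (σ : ℕ → Option ι) (v : ι → ℕ → ℝ) (V : ι → ℝ), (∀ t j, σ t = some j → j ∈ S) ∧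
      ∀ j ∈ S, q ≤ v j 0 ∧ ∀ t, 0 < v j t ∧ v j t ≤ V j ∧
        a j ^ 2 / (if σ t = some j then ρ else 1) * v j t + q ≤ v j (t + 1) := by
  obtain ⟨N, σ, hN, hper, hσ, hcount⟩ := exists_periodic_schedule S (fun j => 2 * Real.log (a j))
    (fun j hj => by have := Real.log_pos (ha j hj); positivity) (Real.log ρ)
    (fun hS => by rw [← Finset.mul_sum]; linarith [hcap hS])
  have hρ0 : 0 < ρ := by linarith
  have hex : ∀ j, ∃ (v : ℕ → ℝ) (V : ℝ), j ∈ S → q ≤ v 0 ∧ ∀ t, 0 < v t ∧ v t ≤ V ∧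
      a j ^ 2 / (if σ t = some j then ρ else 1) * v t + q ≤ v (t + 1) := by
    intro j
    by_cases hj : j ∈ S
    · have haj : 0 < a j := by linarith [ha j hj]
      have hpos : ∀ t, 0 < a j ^ 2 / (if σ t = some j then ρ else 1) := fun t => by
        split_ifs <;> positivity
      obtain ⟨v, V, h⟩ := exists_bounded_supersolution
        (fun t => a j ^ 2 / (if σ t = some j then ρ else 1)) N hN hpos
        (fun t => by simp only [hper t]) (by
          rw [← Real.log_neg_iff (Finset.prod_pos fun t _ => hpos t), Finset.prod_div_distrib,
            Finset.prod_const, Finset.card_range, Finset.prod_ite, Finset.prod_const,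
            Finset.prod_const_one, mul_one, Real.log_div (by positivity) (by positivity),
            Real.log_pow, Real.log_pow, Real.log_pow]
          have := hcount j hj
          push_cast
          linarith) q hq
      exact ⟨v, V, fun _ => h⟩
    · exact ⟨0, 0, fun h => absurd h hj⟩
  choose v V h using hex
  exact ⟨σ, v, V, hσ, fun j hj => h j hj⟩

/-! ### Real modal coordinates -/

section Modal

variable {k : ℕ} {A : Matrix (Fin k) (Fin k) ℝ} {lam : Fin k → ℂ}

/-- Complex conjugation maps left eigenvectors of a real matrix to left eigenvectors for the
conjugate eigenvalue. -/
lemma hasEigenvector_conj {μ : ℂ} {v : Fin k → ℂ}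
    (hv : Module.End.HasEigenvector (Matrix.toLin' (A.map Complex.ofReal)ᵀ) μ v) :
    Module.End.HasEigenvector (Matrix.toLin' (A.map Complex.ofReal)ᵀ) (star μ) (star v) := by
  refine ⟨Module.End.mem_eigenspace_iff.2 ?_, by simpa using hv.2⟩
  have h := Module.End.mem_eigenspace_iff.1 hv.1
  rw [Matrix.toLin'_apply] at h ⊢
  funext a
  have ha := congrArg star (congrFun h a)
  simpa [Matrix.mulVec, dotProduct] using ha

/-- A real eigenvalue has a real left eigenvector. -/
lemma exists_star_fixed_hasEigenvector {μ : ℂ} {v : Fin k → ℂ} (hμ : star μ = μ)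
    (hv : Module.End.HasEigenvector (Matrix.toLin' (A.map Complex.ofReal)ᵀ) μ v) :
    ∃ u, Module.End.HasEigenvector (Matrix.toLin' (A.map Complex.ofReal)ᵀ) μ u ∧ star u = u := by
  by_cases h : v + star v = 0
  · -- `v` is purely imaginary.
    refine ⟨Complex.I • v, ⟨Submodule.smul_mem _ _ hv.1, by simpa using hv.2⟩, ?_⟩
    rw [star_smul, eq_neg_of_add_eq_zero_right h]
    simp
  · have hv' := hasEigenvector_conj hv
    rw [hμ] at hv'
    exact ⟨v + star v, ⟨Submodule.add_mem _ hv.1 hv'.1, h⟩, by rw [star_add, star_star, add_comm]⟩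

/-- A basis of left eigenvectors of a real matrix with distinct eigenvalues, chosen so that
conjugate eigenvalues have conjugate eigenvectors; `τ` pairs up conjugate eigenvalues. -/
lemma exists_conj_invariant_eigenvectors
    (hlam : (A.map Complex.ofReal).charpoly = ∏ j, (Polynomial.X - Polynomial.C (lam j)))
    (hdistinct : Function.Injective lam) :
    ∃ (V : Fin k → Fin k → ℂ) (τ : Fin k → Fin k),
      (∀ j, Module.End.HasEigenvector (Matrix.toLin' (A.map Complex.ofReal)ᵀ) (lam j) (V j)) ∧
      (∀ j, lam (τ j) = star (lam j)) ∧ ∀ j, V (τ j) = star (V j) := by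
  set f : Module.End ℂ (Fin k → ℂ) := Matrix.toLin' (A.map Complex.ofReal)ᵀ with hf
  have hroot : ∀ μ : ℂ, f.HasEigenvalue μ ↔ ∃ j, lam j = μ := fun μ => by
    rw [Module.End.hasEigenvalue_iff_isRoot_charpoly, hf, Matrix.charpoly_toLin',
      Matrix.charpoly_transpose, hlam, Polynomial.IsRoot.def, Polynomial.eval_prod,
      Finset.prod_eq_zero_iff]
    simp [sub_eq_zero, eq_comm]
  have hev : ∀ j, ∃ u, f.HasEigenvector (lam j) u ∧ (star (lam j) = lam j → star u = u) :=
    fun j => by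
      obtain ⟨v, hv⟩ := ((hroot (lam j)).2 ⟨j, rfl⟩).exists_hasEigenvector
      by_cases h : star (lam j) = lam j
      · obtain ⟨u, hu, hu'⟩ := exists_star_fixed_hasEigenvector h hv
        exact ⟨u, hu, fun _ => hu'⟩
      · exact ⟨v, hv, fun h' => absurd h' h⟩
  choose u hu hu' using hev
  have hτ : ∀ j, ∃ j', lam j' = star (lam j) := fun j =>
    (hroot _).1 (Module.End.hasEigenvalue_of_hasEigenvector (hasEigenvector_conj (hu j)))
  choose τ hτ using hτ
  have hττ : ∀ j, τ (τ j) = j := fun j => hdistinct (by rw [hτ, hτ, star_star])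
  -- Of each conjugate pair, the eigenvalue in the upper half plane determines both eigenvectors.
  refine ⟨fun j => if 0 ≤ (lam j).im then u j else star (u (τ j)), τ, fun j => ?_, hτ, fun j => ?_⟩
  · dsimp only
    split_ifs
    · exact hu j
    · have := hasEigenvector_conj (hu (τ j))
      rwa [hτ, star_star] at this
  · have him : (lam (τ j)).im = -(lam j).im := by rw [hτ]; simp
    dsimp only
    rw [hττ, him]
    rcases lt_trichotomy (lam j).im 0 with h | h | h
    · rw [if_pos (by linarith), if_neg (by linarith), star_star]
    · have hreal : star (lam j) = lam j := Complex.conj_eq_iff_im.2 h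
      have hj : τ j = j := hdistinct (by rw [hτ, hreal])
      rw [if_pos (by linarith), if_pos (by linarith), hj, hu' j hreal]
    · rw [if_neg (by linarith), if_pos h.le]

/-- The coordinates of a real vector with respect to an invertible complex matrix control it. -/
lemma exists_sum_sq_le_of_isUnit {V : Matrix (Fin k) (Fin k) ℂ} (hV : IsUnit V) :
    ∃ K : ℝ, 0 ≤ K ∧ ∀ x : Fin k → ℝ,
      ∑ a, x a ^ 2 ≤ K * ∑ j, ‖(V *ᵥ fun a => (x a : ℂ)) j‖ ^ 2 := by
  refine ⟨∑ a, ∑ j, ‖V⁻¹ a j‖ ^ 2, by positivity, fun x => ?_⟩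
  set ε := V *ᵥ fun a => (x a : ℂ) with hε
  have hx : ∀ a, (x a : ℂ) = ∑ j, V⁻¹ a j * ε j := fun a => by
    have : V⁻¹ *ᵥ ε = fun a => (x a : ℂ) := by
      rw [hε, Matrix.mulVec_mulVec, Matrix.nonsing_inv_mul _ ((Matrix.isUnit_iff_isUnit_det _).1 hV),
        Matrix.one_mulVec]
    exact (congrFun this a).symm
  rw [Finset.sum_mul]
  refine Finset.sum_le_sum fun a _ => ?_
  have h1 : |x a| ≤ ∑ j, ‖V⁻¹ a j‖ * ‖ε j‖ := by
    rw [← Real.norm_eq_abs, ← Complex.norm_real, hx a]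
    exact (norm_sum_le _ _).trans_eq (by simp)
  calc x a ^ 2 = |x a| ^ 2 := (sq_abs _).symm
    _ ≤ (∑ j, ‖V⁻¹ a j‖ * ‖ε j‖) ^ 2 := by gcongr
    _ ≤ _ := Finset.sum_mul_sq_le_sq_mul_sq _ _ _

/-- Real modal coordinates in which the source is a family of decoupled scalar modes with growth
factors `‖lam j‖`. The `j`-th coordinate at time `t` is the real or the imaginary part of the
complex modal coordinate, turned back by `t` times the argument of `lam j`. The two members of
a conjugate pair thus give one real coordinate each. -/
lemma exists_modal_rows
    (hlam : (A.map Complex.ofReal).charpoly = ∏ j, (Polynomial.X - Polynomial.C (lam j)))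
    (hdistinct : Function.Injective lam) (hne : ∀ j, lam j ≠ 0) :
    ∃ (R : ℕ → Matrix (Fin k) (Fin k) ℝ) (C K : ℝ), 0 ≤ K ∧
      (∀ t, R (t + 1) * A = Matrix.diagonal (fun j => ‖lam j‖) * R t) ∧
      (∀ t j, LinearCode.ReadsOnlyModes A lam {j} (R t j)) ∧
      (∀ t j a, |R t j a| ≤ C) ∧
      ∀ t (x : Fin k → ℝ), ∑ a, x a ^ 2 ≤ K * ∑ j, (R t *ᵥ x) j ^ 2 := by
  obtain ⟨V, τ, hV, hτ, hVτ⟩ := exists_conj_invariant_eigenvectors hlam hdistinct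
  have hunit : IsUnit (Matrix.of V) := Matrix.linearIndependent_rows_iff_isUnit.1
    (Module.End.eigenvectors_linearIndependent' _ lam hdistinct V hV)
  obtain ⟨K, hK, hKx⟩ := exists_sum_sq_le_of_isUnit hunit
  have hnorm : ∀ j, ‖lam j‖ ≠ 0 := fun j => norm_ne_zero_iff.2 (hne j)
  let ph : Fin k → ℂ := fun j => star (lam j) / ‖lam j‖
  have hph : ∀ j, ph j * lam j = ‖lam j‖ := fun j => by
    have h0 : (‖lam j‖ : ℂ) ≠ 0 := by exact_mod_cast hnorm j
    simp only [ph]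
    rw [div_mul_eq_mul_div, div_eq_iff h0, Complex.star_def, Complex.conj_mul', sq]
  have hph1 : ∀ j, ‖ph j‖ = 1 := fun j => by
    simp [ph, hnorm j]
  have hphτ : ∀ j, ph (τ j) = star (ph j) := fun j => by
    simp [ph, hτ]
  let c : Fin k → ℂ := fun j => if 0 ≤ (lam j).im then 1 else Complex.I
  have hc1 : ∀ j, ‖c j‖ = 1 := fun j => by
    simp only [c]; split_ifs <;> simp
  let R : ℕ → Matrix (Fin k) (Fin k) ℝ := fun t => Matrix.of fun j a => (c j * ph j ^ t * V j a).re
  have hRapp : ∀ t j a, R t j a = (c j * ph j ^ t * V j a).re := fun _ _ _ => rfl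
  refine ⟨R, ∑ j, ∑ a, ‖V j a‖, K * (2 * k), by positivity, fun t => ?_, fun t j => ?_,
    fun t j a => ?_, fun t x => ?_⟩
  · ext j a
    have hVj := congrFun (Module.End.mem_eigenspace_iff.1 (hV j).1) a
    simp only [Matrix.toLin'_apply, Matrix.mulVec, dotProduct, Matrix.transpose_apply,
      Matrix.map_apply, Pi.smul_apply, smul_eq_mul] at hVj
    rw [Matrix.diagonal_mul, Matrix.mul_apply]
    have h1 : ∑ b, R (t + 1) j b * A b a = (c j * ph j ^ (t + 1) * ∑ b, A b a * V j b).re := by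
      rw [Finset.mul_sum, Complex.re_sum]
      refine Finset.sum_congr rfl fun b _ => ?_
      rw [hRapp, mul_left_comm, Complex.re_ofReal_mul, mul_comm]
    rw [h1, hVj]
    have h2 : c j * ph j ^ (t + 1) * (lam j * V j a) =
        (‖lam j‖ : ℂ) * (c j * ph j ^ t * V j a) := by
      rw [← hph j]; ring
    rw [h2, Complex.re_ofReal_mul, hRapp]
  · refine ⟨(c j * ph j ^ t) • V j, ?_, fun a => rfl⟩
    simpa using Submodule.smul_mem _ _ (hV j).1
  · refine (Complex.abs_re_le_norm _).trans ?_
    rw [norm_mul, norm_mul, norm_pow, hc1, hph1, one_pow, one_mul, one_mul]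
    exact (Finset.single_le_sum (f := fun a => ‖V j a‖) (fun _ _ => norm_nonneg _)
      (Finset.mem_univ a)).trans (Finset.single_le_sum (f := fun j => ∑ a, ‖V j a‖)
        (fun _ _ => by positivity) (Finset.mem_univ j))
  · set ε := Matrix.of V *ᵥ fun a => (x a : ℂ) with hε
    have hεj : ∀ j, ε j = ∑ a, V j a * x a := fun j => rfl
    have hR : ∀ j, (R t *ᵥ x) j = (c j * ph j ^ t * ε j).re := fun j => by
      rw [hεj, Finset.mul_sum, Complex.re_sum, Matrix.mulVec, dotProduct]
      refine Finset.sum_congr rfl fun a _ => ?_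
      rw [hRapp, ← mul_assoc, Complex.re_mul_ofReal]
    have hετ : ∀ j, ε (τ j) = star (ε j) := fun j => by
      simp [hεj, hVτ]
    -- The real coordinates of a conjugate pair are, up to sign, the real and the imaginary part of
    -- one complex number `y` of absolute value `‖ε j‖`.
    have hpair : ∀ j, ‖ε j‖ ^ 2 ≤ (R t *ᵥ x) j ^ 2 + (R t *ᵥ x) (τ j) ^ 2 := fun j => by
      set y := ph j ^ t * ε j with hy
      have hyn : ‖ε j‖ ^ 2 = y.re ^ 2 + y.im ^ 2 := by
        have : ‖ε j‖ = ‖y‖ := by rw [hy, norm_mul, norm_pow, hph1, one_pow, one_mul]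
        rw [this, Complex.sq_norm, Complex.normSq_apply]; ring
      have hyτ : ph (τ j) ^ t * ε (τ j) = star y := by
        rw [hphτ, hετ, hy, star_mul', star_pow]
      have him : (lam (τ j)).im = -(lam j).im := by rw [hτ]; simp
      rw [hyn, hR, hR, mul_assoc, mul_assoc, hyτ, ← hy]
      simp only [c, him]
      rcases lt_trichotomy (lam j).im 0 with h | h | h
      · rw [if_neg (by linarith), if_pos (by linarith)]
        simp [add_comm]
      · have hreal : star (lam j) = lam j := Complex.conj_eq_iff_im.2 h
        have hj : τ j = j := hdistinct (by rw [hτ, hreal])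
        have hy0 : y.im = 0 := by
          rw [hj] at hyτ
          exact Complex.conj_eq_iff_im.1 hyτ.symm
        rw [if_pos (by linarith), hy0]
        have := sq_nonneg y.re
        simp only [one_mul]
        nlinarith [sq_nonneg (((if 0 ≤ -(lam j).im then 1 else Complex.I) * star y).re)]
      · rw [if_pos h.le, if_neg (by linarith)]
        simp
    have hsum : ∑ j, ‖ε j‖ ^ 2 ≤ 2 * k * ∑ j, (R t *ᵥ x) j ^ 2 := by
      have hle : ∀ j, (R t *ᵥ x) j ^ 2 ≤ ∑ j, (R t *ᵥ x) j ^ 2 := fun j =>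
        Finset.single_le_sum (f := fun j => (R t *ᵥ x) j ^ 2) (fun _ _ => sq_nonneg _)
          (Finset.mem_univ j)
      calc ∑ j, ‖ε j‖ ^ 2 ≤ ∑ _j : Fin k, 2 * ∑ j, (R t *ᵥ x) j ^ 2 :=
            Finset.sum_le_sum fun j _ => by linarith [hpair j, hle j, hle (τ j)]
        _ = _ := by simp; ring
    calc ∑ a, x a ^ 2 ≤ K * ∑ j, ‖ε j‖ ^ 2 := hKx x
      _ ≤ K * (2 * k * ∑ j, (R t *ᵥ x) j ^ 2) := by gcongr
      _ = _ := by ring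

end Modal

/-! ### Second moments -/

section SecondMoments

variable {Ω : Type*} [MeasurableSpace Ω] {P : Measure Ω}

/-- The second moment of a linear combination of three orthogonal random variables. -/
lemma integral_sq_linear_combination {U Y Z : Ω → ℝ} (hU : MemLp U 2 P) (hY : MemLp Y 2 P)
    (hZ : MemLp Z 2 P) (hUY : ∫ ω, U ω * Y ω ∂P = 0) (hUZ : ∫ ω, U ω * Z ω ∂P = 0)
    (hYZ : ∫ ω, Y ω * Z ω ∂P = 0) (α ℓ : ℝ) :
    ∫ ω, (α * U ω - ℓ * Y ω + Z ω) ^ 2 ∂P =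
      α ^ 2 * ∫ ω, U ω ^ 2 ∂P + ℓ ^ 2 * ∫ ω, Y ω ^ 2 ∂P + ∫ ω, Z ω ^ 2 ∂P := by
  have i1 := hU.integrable_sq.const_mul (α ^ 2)
  have i2 := hY.integrable_sq.const_mul (ℓ ^ 2)
  have i3 := hZ.integrable_sq
  have i4 : Integrable (fun ω => -(2 * α * ℓ) * (U ω * Y ω)) P := (hU.integrable_mul hY).const_mul _
  have i5 : Integrable (fun ω => 2 * α * (U ω * Z ω)) P := (hU.integrable_mul hZ).const_mul _
  have i6 : Integrable (fun ω => -(2 * ℓ) * (Y ω * Z ω)) P := (hY.integrable_mul hZ).const_mul _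
  have h : ∀ ω, (α * U ω - ℓ * Y ω + Z ω) ^ 2 =
      (α ^ 2 * U ω ^ 2 + ℓ ^ 2 * Y ω ^ 2 + Z ω ^ 2) +
        (-(2 * α * ℓ) * (U ω * Y ω) + 2 * α * (U ω * Z ω) + -(2 * ℓ) * (Y ω * Z ω)) :=
    fun ω => by ring
  simp_rw [h]
  have i12 : Integrable (fun ω => α ^ 2 * U ω ^ 2 + ℓ ^ 2 * Y ω ^ 2) P := i1.add i2
  have i123 : Integrable (fun ω => α ^ 2 * U ω ^ 2 + ℓ ^ 2 * Y ω ^ 2 + Z ω ^ 2) P := i12.add i3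
  have i45 : Integrable (fun ω => -(2 * α * ℓ) * (U ω * Y ω) + 2 * α * (U ω * Z ω)) P := i4.add i5
  have i456 : Integrable (fun ω =>
    -(2 * α * ℓ) * (U ω * Y ω) + 2 * α * (U ω * Z ω) + -(2 * ℓ) * (Y ω * Z ω)) P := i45.add i6
  rw [integral_add i123 i456, integral_add i12 i3, integral_add i1 i2, integral_add i45 i6,
    integral_add i4 i5]
  simp only [integral_const_mul, hUY, hUZ, hYZ]
  ring

/-- The second moments of a scalar linear recursion that is driven by mutually orthogonal noise
terms are bounded by any supersolution of the variance recursion. -/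
lemma second_moment_le {e z w : ℕ → Ω → ℝ} {α ℓ v : ℕ → ℝ} {q : ℝ}
    (he : MemLp (e 0) 2 P) (hz : ∀ t, MemLp (z t) 2 P) (hw : ∀ t, MemLp (w t) 2 P)
    (hez : ∀ t, ∫ ω, e 0 ω * z t ω ∂P = 0) (hew : ∀ t, ∫ ω, e 0 ω * w t ω ∂P = 0)
    (hzz : ∀ s t, s < t → ∫ ω, z s ω * z t ω ∂P = 0)
    (hww : ∀ s t, s < t → ∫ ω, w s ω * w t ω ∂P = 0)
    (hzw : ∀ s t, ∫ ω, z s ω * w t ω ∂P = 0)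
    (hrec : ∀ t ω, e (t + 1) ω = α t * e t ω - ℓ t * z t ω + w t ω)
    (hz2 : ∀ t, ∫ ω, z t ω ^ 2 ∂P ≤ 1) (hw2 : ∀ t, ∫ ω, w t ω ^ 2 ∂P ≤ q)
    (hv0 : ∫ ω, e 0 ω ^ 2 ∂P ≤ v 0)
    (hv : ∀ t, α t ^ 2 * v t + ℓ t ^ 2 + q ≤ v (t + 1)) (t : ℕ) :
    MemLp (e t) 2 P ∧ ∫ ω, e t ω ^ 2 ∂P ≤ v t := by
  have hstep : ∀ t (y : Ω → ℝ), MemLp (e t) 2 P → MemLp y 2 P →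
      ∫ ω, e (t + 1) ω * y ω ∂P = α t * ∫ ω, e t ω * y ω ∂P - ℓ t * ∫ ω, z t ω * y ω ∂P +
        ∫ ω, w t ω * y ω ∂P := fun t y het hy => by
    have i1 : Integrable (fun ω => α t * (e t ω * y ω)) P := (het.integrable_mul hy).const_mul _
    have i2 : Integrable (fun ω => ℓ t * (z t ω * y ω)) P := ((hz t).integrable_mul hy).const_mul _
    have i3 : Integrable (fun ω => w t ω * y ω) P := (hw t).integrable_mul hy
    have h : ∀ ω, e (t + 1) ω * y ω =
        α t * (e t ω * y ω) - ℓ t * (z t ω * y ω) + w t ω * y ω := fun ω => by rw [hrec]; ring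
    simp_rw [h]
    have i12 : Integrable (fun ω => α t * (e t ω * y ω) - ℓ t * (z t ω * y ω)) P := i1.sub i2
    rw [integral_add i12 i3, integral_sub i1 i2, integral_const_mul, integral_const_mul]
  have main : ∀ t, MemLp (e t) 2 P ∧ ∫ ω, e t ω ^ 2 ∂P ≤ v t ∧
      (∀ s, t ≤ s → ∫ ω, e t ω * z s ω ∂P = 0) ∧ ∀ s, t ≤ s → ∫ ω, e t ω * w s ω ∂P = 0 := by
    intro t
    induction t with
    | zero => exact ⟨he, hv0, fun s _ => hez s, fun s _ => hew s⟩
    | succ t ih =>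
      obtain ⟨ihL, ihv, ihz, ihw⟩ := ih
      refine ⟨?_, ?_, fun s hs => ?_, fun s hs => ?_⟩
      · rw [funext (hrec t)]
        exact ((ihL.const_mul _).sub ((hz t).const_mul _)).add (hw t)
      · simp_rw [hrec]
        rw [integral_sq_linear_combination ihL (hz t) (hw t) (ihz t le_rfl) (ihw t le_rfl) (hzw t t)]
        have h1 := mul_le_mul_of_nonneg_left ihv (sq_nonneg (α t))
        have h2 := mul_le_mul_of_nonneg_left (hz2 t) (sq_nonneg (ℓ t))
        linarith [hv t, hw2 t]
      · have : ∫ ω, w t ω * z s ω ∂P = 0 := by simpa only [mul_comm] using hzw s t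
        rw [hstep t _ ihL (hz s), ihz s (by omega), hzz t s (by omega), this]
        simp
      · rw [hstep t _ ihL (hw s), ihw s (by omega), hzw, hww t s (by omega)]
        simp
  exact ⟨(main t).1, (main t).2.1⟩

variable {k : ℕ}

/-- A linear functional of a centred Gaussian vector is centred and square integrable, and its
second moment is given by the covariance matrix. -/
lemma linear_functional_of_multivariateGaussian {Q : Matrix (Fin k) (Fin k) ℝ}
    (hQ : Q.PosSemidef) {X : Ω → EuclideanSpace ℝ (Fin k)} (hX : Measurable X)
    (hlaw : P.map X = multivariateGaussian 0 Q) (r : Fin k → ℝ) :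
    MemLp (fun ω => r ⬝ᵥ X ω) 2 P ∧ ∫ ω, r ⬝ᵥ X ω ∂P = 0 ∧
      ∫ ω, (r ⬝ᵥ X ω) ^ 2 ∂P = r ⬝ᵥ Q *ᵥ r := by
  have hinner : ∀ ω, r ⬝ᵥ X ω = inner ℝ (WithLp.toLp 2 r : EuclideanSpace ℝ (Fin k)) (X ω) :=
      fun ω => by
    simp [PiLp.inner_apply, dotProduct, mul_comm]
  simp_rw [hinner]
  have hid : MemLp id 2 (multivariateGaussian 0 Q) := IsGaussian.memLp_two_id
  have hL : MemLp (fun x => inner ℝ (WithLp.toLp 2 r : EuclideanSpace ℝ (Fin k)) x) 2 (P.map X) := by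
    rw [hlaw]
    exact hid.const_inner _
  refine ⟨hL.comp_of_map hX.aemeasurable, ?_, ?_⟩
  · rw [← integral_map (φ := X)
      (f := fun x => inner ℝ (WithLp.toLp 2 r : EuclideanSpace ℝ (Fin k)) x)
      hX.aemeasurable hL.1, hlaw]
    have h := integral_inner (𝕜 := ℝ) (hid.integrable (by norm_num))
      (WithLp.toLp 2 r : EuclideanSpace ℝ (Fin k))
    rw [integral_id_multivariateGaussian', inner_zero_right] at h
    exact h
  · rw [← integral_map (φ := X)
      (f := fun x => inner ℝ (WithLp.toLp 2 r : EuclideanSpace ℝ (Fin k)) x ^ 2)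
      hX.aemeasurable (hL.1.pow 2), hlaw]
    have h := covarianceBilin_apply hid (WithLp.toLp 2 r) (WithLp.toLp 2 r)
    rw [covarianceBilin_multivariateGaussian hQ] at h
    simp only [integral_id_multivariateGaussian', sub_zero] at h
    simp_rw [sq]
    exact h.symm

/-- Functions of independent random variables are uncorrelated when one of them is centred. -/
lemma integral_mul_eq_zero_of_indepFun {E F : Type*} [MeasurableSpace E] [MeasurableSpace F]
    {X : Ω → E} {Y : Ω → F} (hXY : IndepFun X Y P) {f : E → ℝ} {g : F → ℝ}
    (hf : Measurable f) (hg : Measurable g) (hX : Measurable X) (hY : Measurable Y)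
    (h0 : ∫ ω, g (Y ω) ∂P = 0) : ∫ ω, f (X ω) * g (Y ω) ∂P = 0 := by
  have h := (hXY.comp hf hg).integral_mul_eq_mul_integral
    (hf.comp hX).aestronglyMeasurable (hg.comp hY).aestronglyMeasurable
  have h0' : ∫ ω, (g ∘ Y) ω ∂P = 0 := h0
  rw [h0', mul_zero] at h
  exact h

end SecondMoments

/-! ### Error feedback codes -/

section ErrorFeedback

variable {k n : ℕ}

/-- The error feedback code with modal coordinates `R t`, modal dynamics `D`, encoder gains `G t`
and decoder gains `L t`. The decoder tracks the modal coordinates `R t S_t` of the source by the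
recursive estimate `x_{t+1} = D x_t + L_t Y_t`, `x_0 = 0`. The encoder, which knows `x_t` by
feedback, sends `X_t = G_t (R_t S_t - x_t)` and adds no noise of its own. -/
noncomputable def errorFeedbackCode (R : ℕ → Matrix (Fin k) (Fin k) ℝ) (D : Matrix (Fin k) (Fin k) ℝ)
    (G : ℕ → Matrix (Fin n) (Fin k) ℝ) (L : ℕ → Matrix (Fin k) (Fin n) ℝ) : LinearCode k n where
  Ξ t s := if s = t then G t * R t else 0
  Ψ t s := -(G t * (D ^ (t - 1 - s) * L s))
  Θ _ := 0
  Θ_posSemidef _ := Matrix.PosSemidef.zero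
  g t y := Matrix.toEuclideanLin (R (t + 1))⁻¹
    (∑ r : Fin (t + 1), Matrix.toEuclideanLin (D ^ (t - r) * L r) (y r))
  g_measurable t := by
    have h : ∀ (m : ℕ) (B : Matrix (Fin k) (Fin m) ℝ), Continuous (Matrix.toEuclideanLin B) :=
      fun m B => LinearMap.continuous_of_finiteDimensional _
    exact ((h _ _).comp (continuous_finsetSum _ fun r _ =>
      (h _ _).comp (continuous_apply r))).measurable

/-- The decoder's running estimate of the modal coordinates, from the channel outputs `y`. -/
noncomputable def modalEstimate (D : Matrix (Fin k) (Fin k) ℝ) (L : ℕ → Matrix (Fin k) (Fin n) ℝ)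
    (y : ℕ → EuclideanSpace ℝ (Fin n)) (t : ℕ) : EuclideanSpace ℝ (Fin k) :=
  ∑ r : Fin t, Matrix.toEuclideanLin (D ^ (t - 1 - r) * L r) (y r)

lemma toEuclideanLin_mul {l m o : ℕ} (B : Matrix (Fin l) (Fin m) ℝ) (C : Matrix (Fin m) (Fin o) ℝ)
    (x : EuclideanSpace ℝ (Fin o)) :
    Matrix.toEuclideanLin (B * C) x = Matrix.toEuclideanLin B (Matrix.toEuclideanLin C x) := by
  simp [Matrix.toLpLin_apply]

lemma modalEstimate_succ (D : Matrix (Fin k) (Fin k) ℝ) (L : ℕ → Matrix (Fin k) (Fin n) ℝ)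
    (y : ℕ → EuclideanSpace ℝ (Fin n)) (t : ℕ) :
    modalEstimate D L y (t + 1) =
      Matrix.toEuclideanLin D (modalEstimate D L y t) + Matrix.toEuclideanLin (L t) (y t) := by
  unfold modalEstimate
  rw [Fin.sum_univ_castSucc, map_sum]
  congr 1
  · refine Finset.sum_congr rfl fun r _ => ?_
    have hr : t + 1 - 1 - (r : ℕ) = (t - 1 - r) + 1 := by have := r.2; omega
    rw [← toEuclideanLin_mul, ← Matrix.mul_assoc, ← pow_succ', ← hr, Fin.val_castSucc]
  · simp

variable (R : ℕ → Matrix (Fin k) (Fin k) ℝ) (D : Matrix (Fin k) (Fin k) ℝ)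
  (G : ℕ → Matrix (Fin n) (Fin k) ℝ) (L : ℕ → Matrix (Fin k) (Fin n) ℝ) (h : Fin n → ℝ)
  (s : ℕ → EuclideanSpace ℝ (Fin k)) (z : ℕ → EuclideanSpace ℝ (Fin n))

/-- The error of the modal estimate of an error feedback code along one sample path. -/
noncomputable def modalError (t : ℕ) : EuclideanSpace ℝ (Fin k) :=
  Matrix.toEuclideanLin (R t) (s t) -
    modalEstimate D L ((errorFeedbackCode R D G L).output h s z 0) t

lemma errorFeedbackCode_input (t : ℕ) :
    (errorFeedbackCode R D G L).input h s z 0 t =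
      Matrix.toEuclideanLin (G t) (modalError R D G L h s z t) := by
  have hΞ : ∑ r ∈ Finset.range (t + 1),
      Matrix.toEuclideanLin ((errorFeedbackCode R D G L).Ξ t r) (s r) =
      Matrix.toEuclideanLin (G t) (Matrix.toEuclideanLin (R t) (s t)) := by
    rw [Finset.sum_eq_single t]
    · simp [errorFeedbackCode]
    · intro r _ hr
      simp [errorFeedbackCode, hr]
    · simp
  rw [LinearCode.input, LinearCode.encode, hΞ, modalError, map_sub, modalEstimate, map_sum]
  simp [errorFeedbackCode, sub_eq_add_neg]

lemma modalError_zero : modalError R D G L h s z 0 = Matrix.toEuclideanLin (R 0) (s 0) := by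
  simp [modalError, modalEstimate]

lemma modalError_succ {A : Matrix (Fin k) (Fin k) ℝ} (hR : ∀ t, R (t + 1) * A = D * R t)
    (w : ℕ → EuclideanSpace ℝ (Fin k)) (t : ℕ)
    (hs : s (t + 1) = Matrix.toEuclideanLin A (s t) + w t) :
    modalError R D G L h s z (t + 1) =
      Matrix.toEuclideanLin D (modalError R D G L h s z t) +
        Matrix.toEuclideanLin (R (t + 1)) (w t) -
        Matrix.toEuclideanLin (L t) (Matrix.toEuclideanLin (Matrix.diagonal h)
          (Matrix.toEuclideanLin (G t) (modalError R D G L h s z t)) + z t) := by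
  have hout : (errorFeedbackCode R D G L).output h s z 0 t =
      Matrix.toEuclideanLin (Matrix.diagonal h)
        (Matrix.toEuclideanLin (G t) (modalError R D G L h s z t)) + z t := by
    rw [← errorFeedbackCode_input, LinearCode.output, LinearCode.input]
  rw [← hout]
  simp only [modalError]
  rw [modalEstimate_succ, hs, map_add, ← toEuclideanLin_mul, hR, toEuclideanLin_mul, map_sub]
  abel

/-- The prediction error of the source state in modal coordinates. -/
lemma toEuclideanLin_sub_estimate (hR : ∀ t, IsUnit (R t)) (t : ℕ) :
    Matrix.toEuclideanLin (R (t + 1))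
        (s (t + 1) - (errorFeedbackCode R D G L).estimate h s z 0 (t + 1)) =
      modalError R D G L h s z (t + 1) := by
  have hest : (errorFeedbackCode R D G L).estimate h s z 0 (t + 1) =
      Matrix.toEuclideanLin (R (t + 1))⁻¹
        (modalEstimate D L ((errorFeedbackCode R D G L).output h s z 0) (t + 1)) := by
    rfl
  rw [map_sub, hest, ← toEuclideanLin_mul,
    Matrix.mul_nonsing_inv _ ((Matrix.isUnit_iff_isUnit_det _).1 (hR _)), modalError]
  simp [Matrix.toLpLin_apply]

end ErrorFeedback

/-! ### Time-shared error feedback -/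

section TimeSharing

variable {k n : ℕ}

/-- The gain matrix of a time-shared encoder: at time `t`, sub-channel `i` serves the mode
`σ i t`, if any, with gain `κ t (σ i t)`. -/
noncomputable def servedGain (σ : Fin n → ℕ → Option (Fin k)) (κ : ℕ → Fin k → ℝ) (t : ℕ) :
    Matrix (Fin n) (Fin k) ℝ :=
  Matrix.of fun i j => if σ i t = some j then κ t j else 0

lemma toEuclideanLin_servedGain_some {σ : Fin n → ℕ → Option (Fin k)} {κ : ℕ → Fin k → ℝ} {t : ℕ}
    {i : Fin n} {j : Fin k} (h : σ i t = some j) (x : EuclideanSpace ℝ (Fin k)) :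
    Matrix.toEuclideanLin (servedGain σ κ t) x i = κ t j * x j := by
  simp [Matrix.toLpLin_apply, servedGain, Matrix.mulVec, dotProduct, h]

lemma toEuclideanLin_servedGain_none {σ : Fin n → ℕ → Option (Fin k)} {κ : ℕ → Fin k → ℝ} {t : ℕ}
    {i : Fin n} (h : σ i t = none) (x : EuclideanSpace ℝ (Fin k)) :
    Matrix.toEuclideanLin (servedGain σ κ t) x i = 0 := by
  simp [Matrix.toLpLin_apply, servedGain, Matrix.mulVec, dotProduct, h]

/-- If the mode `j` is served by no other sub-channel than `i`, then the decoder updates its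
estimate of that mode from the output of sub-channel `i` only. -/
lemma toEuclideanLin_servedGain_transpose {σ : Fin n → ℕ → Option (Fin k)} {ℓ : ℕ → Fin k → ℝ}
    {t : ℕ} {i : Fin n} {j : Fin k} (hσ : ∀ i', σ i' t = some j → i' = i)
    (y : EuclideanSpace ℝ (Fin n)) :
    Matrix.toEuclideanLin (servedGain σ ℓ t)ᵀ y j = (if σ i t = some j then ℓ t j else 0) * y i := by
  rw [Matrix.toLpLin_apply]
  simp only [Matrix.mulVec, dotProduct, Matrix.transpose_apply, servedGain, Matrix.of_apply]
  refine Finset.sum_eq_single i (fun i' _ hi' => ?_) (by simp)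
  rw [if_neg fun h => hi' (hσ i' h), zero_mul]

/-- Under time sharing, the errors of the modal coordinates obey decoupled scalar recursions. -/
lemma modalError_servedGain_succ {A : Matrix (Fin k) (Fin k) ℝ}
    {R : ℕ → Matrix (Fin k) (Fin k) ℝ} {a : Fin k → ℝ}
    (hR : ∀ t, R (t + 1) * A = Matrix.diagonal a * R t)
    {σ : Fin n → ℕ → Option (Fin k)} {κ ℓ : ℕ → Fin k → ℝ} {h : Fin n → ℝ}
    {s w : ℕ → EuclideanSpace ℝ (Fin k)} {z : ℕ → EuclideanSpace ℝ (Fin n)} {t : ℕ}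
    (hs : s (t + 1) = Matrix.toEuclideanLin A (s t) + w t)
    {i : Fin n} {j : Fin k} (hσ : ∀ i', σ i' t = some j → i' = i) :
    let e := modalError R (Matrix.diagonal a) (servedGain σ κ) (fun t => (servedGain σ ℓ t)ᵀ) h s z
    let ℓ' := if σ i t = some j then ℓ t j else 0
    e (t + 1) j = (a j - ℓ' * h i * κ t j) * e t j - ℓ' * z t i + R (t + 1) j ⬝ᵥ w t := by
  intro e ℓ'
  have h1 : e (t + 1) = _ := modalError_succ R (Matrix.diagonal a) (servedGain σ κ)
    (fun t => (servedGain σ ℓ t)ᵀ) h s z hR w t hs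
  rw [h1, PiLp.sub_apply, PiLp.add_apply, toEuclideanLin_servedGain_transpose hσ, PiLp.add_apply]
  have h2 : ∀ (m : ℕ) (d : Fin m → ℝ) (x : EuclideanSpace ℝ (Fin m)) (l : Fin m),
      Matrix.toEuclideanLin (Matrix.diagonal d) x l = d l * x l := fun m d x l => by
    simp [Matrix.toLpLin_apply, Matrix.mulVec_diagonal]
  have h3 : Matrix.toEuclideanLin (R (t + 1)) (w t) j = R (t + 1) j ⬝ᵥ w t := by
    rw [Matrix.toLpLin_apply]; rfl
  rw [h2, h2, h3]
  simp only [ℓ']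
  by_cases hj : σ i t = some j
  · rw [if_pos hj, toEuclideanLin_servedGain_some hj]
    ring
  · rw [if_neg hj]
    ring

/-- With input power `p`, the linear minimum mean-squared error update divides the variance `v`
of the mode that is served by `1 + h ^ 2 * p`. -/
lemma served_variance (a h p v : ℝ) (hp : 0 ≤ p) (hv : 0 < v) :
    let κ := √(p / v)
    let ℓ := a * h * κ * v / (1 + h ^ 2 * p)
    (a - ℓ * h * κ) ^ 2 * v + ℓ ^ 2 = a ^ 2 / (1 + h ^ 2 * p) * v := by
  intro κ ℓ
  have hκ : κ ^ 2 = p / v := Real.sq_sqrt (by positivity)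
  have hpκ : p = κ ^ 2 * v := by rw [hκ]; field_simp
  have hne : 1 + h ^ 2 * (κ ^ 2 * v) ≠ 0 := by positivity
  simp only [ℓ]
  rw [hpκ]
  field_simp
  ring

end TimeSharing

/-! ### Long-term averages -/

section Averages

variable {Ω : Type*} [MeasurableSpace Ω] {P : Measure Ω}

lemma lintegral_enorm_sq_le {m : ℕ} {ι : Type*} [Fintype ι] {f : Ω → EuclideanSpace ℝ (Fin m)}
    {g : ι → Ω → ℝ} (hg : ∀ j, MemLp (g j) 2 P) {K : ℝ} (hK : 0 ≤ K)
    (hfg : ∀ᵐ ω ∂P, ∑ a, f ω a ^ 2 ≤ K * ∑ j, g j ω ^ 2) {b : ι → ℝ}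
    (hb : ∀ j, ∫ ω, g j ω ^ 2 ∂P ≤ b j) :
    ∫⁻ ω, ‖f ω‖ₑ ^ 2 ∂P ≤ ENNReal.ofReal (K * ∑ j, b j) := by
  have hint : Integrable (fun ω => K * ∑ j, g j ω ^ 2) P :=
    (integrable_finsetSum _ fun j _ => (hg j).integrable_sq).const_mul K
  calc ∫⁻ ω, ‖f ω‖ₑ ^ 2 ∂P ≤ ∫⁻ ω, ENNReal.ofReal (K * ∑ j, g j ω ^ 2) ∂P := by
        refine lintegral_mono_ae (hfg.mono fun ω hω => ?_)
        rw [← ofReal_norm, ← ENNReal.ofReal_pow (norm_nonneg _),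
          EuclideanSpace.real_norm_sq_eq]
        exact ENNReal.ofReal_le_ofReal hω
    _ = ENNReal.ofReal (∫ ω, K * ∑ j, g j ω ^ 2 ∂P) :=
        (ofReal_integral_eq_lintegral_ofReal hint (ae_of_all _ fun ω => by positivity)).symm
    _ ≤ _ := by
        refine ENNReal.ofReal_le_ofReal ?_
        rw [integral_const_mul, integral_finsetSum _ fun j _ => (hg j).integrable_sq]
        exact mul_le_mul_of_nonneg_left (Finset.sum_le_sum fun j _ => hb j) hK

lemma limsup_average_le {u : ℕ → ℝ≥0∞} {b : ℝ≥0∞} (hu : ∀ t, 1 ≤ t → u t ≤ b) :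
    limsup (fun T : ℕ => (T : ℝ≥0∞)⁻¹ * ∑ t ∈ Finset.Icc 1 T, u t) atTop ≤ b := by
  refine limsup_le_of_le (by isBoundedDefault) (Eventually.of_forall fun T => ?_)
  calc (T : ℝ≥0∞)⁻¹ * ∑ t ∈ Finset.Icc 1 T, u t
      ≤ (T : ℝ≥0∞)⁻¹ * ∑ _t ∈ Finset.Icc 1 T, b := by
        gcongr with t ht
        exact hu t (Finset.mem_Icc.1 ht).1
    _ = (T : ℝ≥0∞)⁻¹ * T * b := by simp [mul_assoc]
    _ ≤ 1 * b := by gcongr; exact ENNReal.inv_mul_le_one _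
    _ = b := one_mul b

end Averages

/-! ### The driving noise -/

section Noise

variable {k n : ℕ} {Ω : Type*} [MeasurableSpace Ω] {P : Measure Ω}
  {Q : Matrix (Fin k) (Fin k) ℝ} {Θ : ℕ → Matrix (Fin n) (Fin n) ℝ}
  {S₀ : Ω → EuclideanSpace ℝ (Fin k)} {W : ℕ → Ω → EuclideanSpace ℝ (Fin k)}
  {Z M : ℕ → Ω → EuclideanSpace ℝ (Fin n)}

/-- Additive encoder terms of covariance zero vanish almost surely. -/
lemma LinearCode.IsNoise.ae_eq_zero (hN : LinearCode.IsNoise P Q Θ S₀ W Z M) (hΘ : ∀ t, Θ t = 0) :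
    ∀ᵐ ω ∂P, (fun t => M t ω) = 0 := by
  have h : ∀ t, ∀ᵐ ω ∂P, M t ω = 0 := fun t => by
    have hlaw : P.map (M t) = Measure.dirac 0 := by
      rw [hN.law_M, hΘ, multivariateGaussian]
      simp
    have h0 : ∀ᵐ x ∂(P.map (M t)), x = 0 := by
      rw [hlaw, ae_dirac_eq]
      exact rfl
    exact ae_of_ae_map (hN.measurable_M t).aemeasurable h0
  filter_upwards [ae_all_iff.2 h] with ω hω
  exact funext hω

/-- Second moments along a scalar recursion that is driven by linear functionals of the initial
state, of the source noise, and by one component of the channel noise. -/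
lemma LinearCode.IsNoise.second_moment_le (hN : LinearCode.IsNoise P Q Θ S₀ W Z M)
    (hQ : Q.PosSemidef) {r : ℕ → Fin k → ℝ} {i : Fin n} {q : ℝ} (hr : ∀ t, r t ⬝ᵥ Q *ᵥ r t ≤ q)
    {e : ℕ → Ω → ℝ} {α ℓ v : ℕ → ℝ} (he : ∀ ω, e 0 ω = r 0 ⬝ᵥ S₀ ω)
    (hrec : ∀ t ω, e (t + 1) ω = α t * e t ω - ℓ t * Z t ω i + r (t + 1) ⬝ᵥ W t ω)
    (hv0 : q ≤ v 0) (hv : ∀ t, α t ^ 2 * v t + ℓ t ^ 2 + q ≤ v (t + 1)) (t : ℕ) :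
    MemLp (e t) 2 P ∧ ∫ ω, e t ω ^ 2 ∂P ≤ v t := by
  have hS := linear_functional_of_multivariateGaussian hQ hN.measurable_S₀ hN.law_S₀
  have hW := fun t => linear_functional_of_multivariateGaussian hQ (hN.measurable_W t) (hN.law_W t)
  have hZ : ∀ t, MemLp (fun ω => Z t ω i) 2 P ∧ ∫ ω, Z t ω i ∂P = 0 ∧ ∫ ω, Z t ω i ^ 2 ∂P = 1 :=
    fun t => by
      have := linear_functional_of_multivariateGaussian Matrix.PosSemidef.one (hN.measurable_Z t)
        (hN.law_Z t) (Pi.single i 1)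
      simpa using this
  have hdot : ∀ x : Fin k → ℝ, Measurable fun y : EuclideanSpace ℝ (Fin k) => x ⬝ᵥ y := fun x => by
    unfold dotProduct; fun_prop
  have hev : Measurable fun y : EuclideanSpace ℝ (Fin n) => y i := by fun_prop
  have hWm : Measurable fun ω t => W t ω := measurable_pi_lambda _ hN.measurable_W
  have hZm : Measurable fun ω t => Z t ω := measurable_pi_lambda _ hN.measurable_Z
  have he' : e 0 = fun ω => r 0 ⬝ᵥ S₀ ω := funext he
  refine ZeroDelayJSCC.second_moment_le (e := e) (z := fun t ω => Z t ω i)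
    (w := fun t ω => r (t + 1) ⬝ᵥ W t ω) (α := α) (ℓ := ℓ) (v := v) (q := q) ?_
    (fun t => (hZ t).1) (fun t => (hW t _).1) (fun t => ?_) (fun t => ?_) (fun s t hst => ?_)
    (fun s t hst => ?_) (fun s t => ?_) hrec (fun t => (hZ t).2.2.le)
    (fun t => (hW t _).2.2.trans_le (hr _)) ?_ hv t
  · rw [he']; exact (hS _).1
  · simp_rw [he]
    exact integral_mul_eq_zero_of_indepFun hN.indep_source_Z
      (f := fun x => r 0 ⬝ᵥ x.1) (g := fun y => y t i) ((hdot _).comp measurable_fst)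
      (hev.comp (measurable_pi_apply t)) (hN.measurable_S₀.prodMk hWm) hZm (hZ t).2.1
  · simp_rw [he]
    exact integral_mul_eq_zero_of_indepFun hN.indep_S₀_W
      (f := fun x => r 0 ⬝ᵥ x) (g := fun y => r (t + 1) ⬝ᵥ y t) (hdot _)
      ((hdot _).comp (measurable_pi_apply t)) hN.measurable_S₀ hWm (hW t _).2.1
  · exact integral_mul_eq_zero_of_indepFun (hN.indep_Z.indepFun hst.ne) hev hev
      (hN.measurable_Z s) (hN.measurable_Z t) (hZ t).2.1
  · exact integral_mul_eq_zero_of_indepFun (hN.indep_W.indepFun hst.ne) (hdot _) (hdot _)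
      (hN.measurable_W s) (hN.measurable_W t) (hW t _).2.1
  · simp_rw [mul_comm (Z s _ i)]
    exact integral_mul_eq_zero_of_indepFun hN.indep_source_Z
      (f := fun x => r (t + 1) ⬝ᵥ x.2 t) (g := fun y => y s i)
      ((hdot _).comp ((measurable_pi_apply t).comp measurable_snd))
      (hev.comp (measurable_pi_apply s)) (hN.measurable_S₀.prodMk hWm) hZm (hZ s).2.1
  · simp_rw [he]
    exact ((hS _).2.2.trans_le (hr 0)).trans hv0

end Noise

/-- A quadratic form is bounded on a set of vectors with bounded entries. -/
lemma dotProduct_mulVec_self_le {k : ℕ} (Q : Matrix (Fin k) (Fin k) ℝ) {r : Fin k → ℝ} {C : ℝ}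
    (hr : ∀ a, |r a| ≤ C) : r ⬝ᵥ Q *ᵥ r ≤ ∑ a, ∑ b, C * (|Q a b| * C) := by
  simp only [dotProduct, Matrix.mulVec, Finset.mul_sum]
  refine Finset.sum_le_sum fun a _ => Finset.sum_le_sum fun b _ => (le_abs_self _).trans ?_
  have hC : 0 ≤ C := (abs_nonneg _).trans (hr a)
  rw [abs_mul, abs_mul]
  have := hr a
  have := hr b
  gcongr

/-! ### Achievability -/

section Achievability

variable {k n : ℕ}

lemma LinearCode.ReadsOnlyModes.zero (A : Matrix (Fin k) (Fin k) ℝ) (lam : Fin k → ℂ)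
    (J : Finset (Fin k)) : LinearCode.ReadsOnlyModes A lam J 0 :=
  ⟨0, Submodule.zero_mem _, fun _ => by simp⟩

lemma LinearCode.ReadsOnlyModes.smul {A : Matrix (Fin k) (Fin k) ℝ} {lam : Fin k → ℂ}
    {J J' : Finset (Fin k)} {r : Fin k → ℝ} (hr : LinearCode.ReadsOnlyModes A lam J r)
    (hJ : J ⊆ J') (c : ℝ) : LinearCode.ReadsOnlyModes A lam J' (c • r) := by
  obtain ⟨v, hv, hrv⟩ := hr
  refine ⟨(c : ℂ) • v, Submodule.smul_mem _ _ (SetLike.le_def.1 (biSup_mono fun j hj => hJ hj) hv), fun a => ?_⟩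
  simp [hrv]

/-- A time-shared error feedback code sends every mode over the sub-channel that serves it. -/
lemma sendsModesOver_errorFeedbackCode {A : Matrix (Fin k) (Fin k) ℝ} {lam : Fin k → ℂ}
    {𝒮 : Fin n → Finset (Fin k)} {R : ℕ → Matrix (Fin k) (Fin k) ℝ}
    (hR : ∀ t j, LinearCode.ReadsOnlyModes A lam {j} (R t j)) (D : Matrix (Fin k) (Fin k) ℝ)
    {σ : Fin n → ℕ → Option (Fin k)} (hσ : ∀ i t j, σ i t = some j → j ∈ 𝒮 i)
    (κ : ℕ → Fin k → ℝ) (L : ℕ → Matrix (Fin k) (Fin n) ℝ) :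
    (errorFeedbackCode R D (servedGain σ κ) L).SendsModesOver A lam 𝒮 := by
  intro i t s _
  by_cases hst : s = t
  · subst hst
    have hrow : (errorFeedbackCode R D (servedGain σ κ) L).Ξ s s i =
        fun a => ∑ j, servedGain σ κ s i j * R s j a := by
      funext a
      simp [errorFeedbackCode, Matrix.mul_apply]
    rw [hrow]
    cases h : σ i s with
    | none =>
      convert LinearCode.ReadsOnlyModes.zero A lam (𝒮 i) using 1
      funext a
      simp [servedGain, h]
    | some j =>
      convert (hR s j).smul (Finset.singleton_subset_iff.2 (hσ i s j h)) (κ s j) using 1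
      funext a
      simp [servedGain, h]
  · have hrow : (errorFeedbackCode R D (servedGain σ κ) L).Ξ t s i = 0 := by
      funext a
      simp [errorFeedbackCode, hst]
    rw [hrow]
    exact LinearCode.ReadsOnlyModes.zero A lam (𝒮 i)

/-- A time-shared error feedback code whose gains keep the input power of each sub-channel at most
`π i` is a `(∑ i, π i, D)` code, provided that the variance recursions of all modes have bounded
supersolutions `v`. -/
lemma isFeedbackCode_errorFeedbackCode {A Q : Matrix (Fin k) (Fin k) ℝ} (hQ : Q.PosSemidef)
    {a : Fin k → ℝ} {R : ℕ → Matrix (Fin k) (Fin k) ℝ}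
    (hRA : ∀ t, R (t + 1) * A = Matrix.diagonal a * R t)
    {q : ℝ} (hRq : ∀ t j, R t j ⬝ᵥ Q *ᵥ R t j ≤ q)
    {K : ℝ} (hK : 0 ≤ K) (hRK : ∀ t (x : Fin k → ℝ), ∑ a, x a ^ 2 ≤ K * ∑ j, (R t *ᵥ x) j ^ 2)
    {h π : Fin n → ℝ} (hπ : ∀ i, 0 ≤ π i)
    {σ : Fin n → ℕ → Option (Fin k)} {ι : Fin k → Fin n} (hσ : ∀ i t j, σ i t = some j → i = ι j)
    {v : Fin k → ℕ → ℝ} {V : Fin k → ℝ} (hv0 : ∀ j, q ≤ v j 0) (hvpos : ∀ j t, 0 < v j t)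
    (hvV : ∀ j t, v j t ≤ V j)
    (hv : ∀ j t, a j ^ 2 / (if σ (ι j) t = some j then 1 + h (ι j) ^ 2 * π (ι j) else 1) * v j t + q
      ≤ v j (t + 1))
    {κ ℓ : ℕ → Fin k → ℝ} (hκ : ∀ t j, κ t j = √(π (ι j) / v j t))
    (hℓ : ∀ t j, ℓ t j =
      a j * h (ι j) * κ t j * v j t / (1 + h (ι j) ^ 2 * π (ι j))) :
    (errorFeedbackCode R (Matrix.diagonal a) (servedGain σ κ)
      (fun t => (servedGain σ ℓ t)ᵀ)).IsFeedbackCode.{u} A Q h (∑ i, π i)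
        (K * ∑ j, V j).toNNReal := by
  intro Ω _ P _ S₀ W Z M hN S X Shat
  have hM := hN.ae_eq_zero fun _ => rfl
  have hRunit : ∀ t, IsUnit (R t) := fun t => by
    rw [← Matrix.mulVec_injective_iff_isUnit, ← Matrix.coe_mulVecLin, injective_iff_map_eq_zero]
    intro x hx
    have h0 : ∑ a, x a ^ 2 ≤ 0 := by
      refine (hRK t x).trans_eq ?_
      rw [show R t *ᵥ x = 0 from hx]
      simp
    have h1 := (Finset.sum_eq_zero_iff_of_nonneg fun a _ => sq_nonneg (x a)).1
      (le_antisymm h0 (Finset.sum_nonneg fun a _ => sq_nonneg (x a)))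
    funext a
    exact pow_eq_zero_iff two_ne_zero |>.1 (h1 a (Finset.mem_univ a))
  let e : Ω → ℕ → EuclideanSpace ℝ (Fin k) := fun ω =>
    modalError R (Matrix.diagonal a) (servedGain σ κ) (fun t => (servedGain σ ℓ t)ᵀ) h (S ω)
      (fun t => Z t ω)
  let ℓ' : ℕ → Fin k → ℝ := fun t j => if σ (ι j) t = some j then ℓ t j else 0
  have hvar : ∀ j t, MemLp (fun ω => e ω t j) 2 P ∧ ∫ ω, e ω t j ^ 2 ∂P ≤ v j t := by
    intro j
    refine hN.second_moment_le hQ (r := fun t => R t j) (i := ι j) (q := q) (fun t => hRq t j)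
      (e := fun t ω => e ω t j) (α := fun t => a j - ℓ' t j * h (ι j) * κ t j)
      (ℓ := fun t => ℓ' t j) (v := v j) (fun ω => ?_) (fun t ω => ?_) (hv0 j) (fun t => ?_)
    · simp only [e, modalError_zero]
      rw [Matrix.toLpLin_apply]
      rfl
    · exact modalError_servedGain_succ hRA (w := fun t => W t ω) rfl fun i' => hσ i' t j
    · refine le_trans ?_ (hv j t)
      gcongr
      by_cases hj : σ (ι j) t = some j
      · have := served_variance (a j) (h (ι j)) (π (ι j)) (v j t) (hπ _) (hvpos j t)
        simp only [ℓ', if_pos hj, hℓ, hκ]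
        exact this.le
      · simp [ℓ', if_neg hj]
  constructor
  · refine limsup_average_le fun t _ => ?_
    have hg : ∀ i, MemLp (fun ω => Matrix.toEuclideanLin (servedGain σ κ t) (e ω t) i) 2 P ∧
        ∫ ω, Matrix.toEuclideanLin (servedGain σ κ t) (e ω t) i ^ 2 ∂P ≤ π i := fun i => by
      cases hi : σ i t with
      | none => simpa [toEuclideanLin_servedGain_none hi] using hπ i
      | some j =>
        simp only [toEuclideanLin_servedGain_some hi]
        refine ⟨(hvar j t).1.const_mul _, ?_⟩
        simp_rw [mul_pow]
        rw [integral_const_mul, hκ, Real.sq_sqrt (div_nonneg (hπ _) (hvpos j t).le), hσ i t j hi]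
        calc π (ι j) / v j t * ∫ ω, e ω t j ^ 2 ∂P ≤ π (ι j) / v j t * v j t :=
              mul_le_mul_of_nonneg_left (hvar j t).2 (div_nonneg (hπ _) (hvpos j t).le)
          _ = π (ι j) := div_mul_cancel₀ _ (hvpos j t).ne'
    have := lintegral_enorm_sq_le (f := fun ω => X ω t) (fun i => (hg i).1) zero_le_one
      (hM.mono fun ω hω => ?_) (fun i => (hg i).2)
    · rwa [one_mul] at this
    · simp only [X]
      rw [hω, errorFeedbackCode_input, one_mul]
  · refine limsup_average_le fun t ht => ?_
    obtain ⟨t, rfl⟩ := Nat.exists_eq_add_of_le' ht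
    refine lintegral_enorm_sq_le (fun j => (hvar j (t + 1)).1) hK (hM.mono fun ω hω => ?_)
      (fun j => (hvar j (t + 1)).2.trans (hvV j (t + 1)))
    have hest := toEuclideanLin_sub_estimate R (Matrix.diagonal a) (servedGain σ κ)
      (fun t => (servedGain σ ℓ t)ᵀ) h (S ω) (fun t => Z t ω) hRunit t
    simp only [Shat]
    rw [hω]
    refine (hRK (t + 1) _).trans_eq ?_
    simp only [e]
    rw [← hest, Matrix.toLpLin_apply]

end Achievability

end ZeroDelayJSCC

theorem mainTheorem2 (k n : ℕ)
    -- the source: gain matrix, noise covariance, and the eigenvalues of the gain matrix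
    (A Q : Matrix (Fin k) (Fin k) ℝ) (hQ : Q.PosDef)
    (lam : Fin k → ℂ)
    (hlam : (A.map Complex.ofReal).charpoly =
      ∏ j, (Polynomial.X - Polynomial.C (lam j)))
    (hdistinct : Function.Injective lam) (hunstable : ∀ j, 1 < ‖lam j‖)
    -- the channel gains, and the power constraint
    (h : Fin n → ℝ) (p : ℝ)
    -- the partition of the modes, with possibly empty parts, and the power allocation
    (𝒮 : Fin n → Finset (Fin k))
    (hdisj : Pairwise fun i i' => Disjoint (𝒮 i) (𝒮 i'))
    (hcover : ∀ j, ∃ i, j ∈ 𝒮 i)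
    (π : Fin n → ℝ) (hπ : ∀ i, 0 ≤ π i) (hsum : ∑ i, π i = p)
    (hcap : ∀ i, (𝒮 i).Nonempty →
      ∑ j ∈ 𝒮 i, Real.log ‖lam j‖ < 1 / 2 * Real.log (1 + h i ^ 2 * π i)) :
    ∃ (c : ZeroDelayJSCC.LinearCode k n) (D : ℝ≥0),
      c.IsFeedbackCode.{u} A Q h p D ∧ c.SendsModesOver A lam 𝒮 := by
  open ZeroDelayJSCC in
  obtain ⟨R, C, K, hK, hRA, hRmodes, hRC, hRK⟩ := exists_modal_rows hlam hdistinct fun j =>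
    norm_pos_iff.1 (one_pos.trans (hunstable j))
  -- `|C|` in place of `C` makes the bound `q` on the noise variances visibly nonnegative.
  let q : ℝ := ∑ a, ∑ b, |C| * (|Q a b| * |C|)
  choose ι hι using hcover
  choose σ v V hσ hv using fun i => exists_schedule_variance (𝒮 i) (fun j => ‖lam j‖)
    (fun j _ => hunstable j) (1 + h i ^ 2 * π i)
    (le_add_of_nonneg_right (mul_nonneg (sq_nonneg _) (hπ i))) (hcap i) q
    (Finset.sum_nonneg fun _ _ => Finset.sum_nonneg fun _ _ => by positivity)
  have hσι : ∀ i t j, σ i t = some j → i = ι j := fun i t j hj => by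
    by_contra hne
    exact Finset.disjoint_left.1 (hdisj hne) (hσ i t j hj) (hι j)
  let κ : ℕ → Fin k → ℝ := fun t j => √(π (ι j) / v (ι j) j t)
  let ℓ : ℕ → Fin k → ℝ := fun t j =>
    ‖lam j‖ * h (ι j) * κ t j * v (ι j) j t / (1 + h (ι j) ^ 2 * π (ι j))
  have hcode := isFeedbackCode_errorFeedbackCode.{u} hQ.posSemidef hRA (q := q)
    (fun t j => dotProduct_mulVec_self_le Q fun a => (hRC t j a).trans (le_abs_self C))
    hK hRK hπ hσι (v := fun j => v (ι j) j) (V := fun j => V (ι j) j)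
    (fun j => (hv (ι j) j (hι j)).1) (fun j t => ((hv (ι j) j (hι j)).2 t).1)
    (fun j t => ((hv (ι j) j (hι j)).2 t).2.1) (fun j t => ((hv (ι j) j (hι j)).2 t).2.2)
    (κ := κ) (ℓ := ℓ) (fun _ _ => rfl) (fun _ _ => rfl)
  rw [hsum] at hcode
  exact ⟨_, _, hcode, sendsModesOver_errorFeedbackCode hRmodes _ hσ κ _⟩
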